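/- Let $p$ be an odd prime and let $G$ be a (topologically) finitely generated pro-$p$ group. For a closed normal subgroup $N$ of a pro-$p$ group $H$, let $N^p$ denote the closed subgroup generated by the $p$-th powers of elements of $N$, and call $N$ powerfully embedded in $H$ if the closed subgroup $[N,H]$ is contained in $N^p$. Suppose that $G$ has finite powerful class, that is, there are closed normal subgroups $1=N_0\le N_1\le\cdots\le N_k=G$ of $G$, for some $k \ge 0$, such that $N_{i+1}/N_i$ is powerfully embedded in $G/N_i$ for all $0\le i<k$. Then the set of all elements of finite order of $G$ is a finite subgroup of $G$. -/

import Mathlib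

namespace PowerfulClass

/-- A pro-`p` group: a profinite group (compact, Hausdorff, totally disconnected topological group)
in which every open normal subgroup has index a power of `p`. -/
structure IsProPGroup (p : ℕ) (G : Type*) [Group G] [TopologicalSpace G] : Prop where
  isTopologicalGroup : IsTopologicalGroup G
  compactSpace : CompactSpace G
  t2Space : T2Space G
  totallyDisconnectedSpace : TotallyDisconnectedSpace G
  index_eq_pow : ∀ U : Subgroup G, U.Normal → IsOpen (U : Set G) → ∃ n : ℕ, U.index = p ^ n

section

variable {G : Type*} [Group G] [TopologicalSpace G] [IsTopologicalGroup G]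

variable (G) in
/-- Finite generation in the topological sense: some finite subset generates a dense subgroup. -/
def IsTopologicallyFG : Prop :=
  ∃ S : Set G, S.Finite ∧ (Subgroup.closure S).topologicalClosure = ⊤

/-- `N ^ p`: the closed subgroup generated by the `p`-th powers of the elements of `N`. -/
def powSubgroup (p : ℕ) (N : Subgroup G) : Subgroup G :=
  (Subgroup.closure {y : G | ∃ x ∈ N, y = x ^ p}).topologicalClosure

/-- A subgroup `N` of `G` is powerfully embedded (for an odd prime `p`) if it is closed and normal
and `[N, G] ≤ N ^ p`, where both sides are taken topologically closed. -/
structure IsPowerfullyEmbedded (p : ℕ) (N : Subgroup G) : Prop where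
  isClosed : IsClosed (N : Set G)
  normal : N.Normal
  commutator_le : (⁅N, (⊤ : Subgroup G)⁆).topologicalClosure ≤ powSubgroup p N

/-- An `η`-series of closed subgroups: an ascending series `1 = N 0 ≤ N 1 ≤ ⋯` of closed normal
subgroups of `G` such that `N (i + 1) / N i` is powerfully embedded in `G / N i` for all `i`. -/
structure IsEtaSeries (p : ℕ) (N : ℕ → Subgroup G) : Prop where
  zero : N 0 = ⊥
  mono : Monotone N
  isClosed : ∀ i, IsClosed (N i : Set G)
  normal : ∀ i, (N i).Normal
  powerfullyEmbedded : ∀ i, haveI := normal i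
    IsPowerfullyEmbedded p ((N (i + 1)).map (QuotientGroup.mk' (N i)))

variable (G) in
/-- `G` has finite powerful class: some `η`-series of closed subgroups reaches `G` after finitely
many steps. -/
def HasFinitePowerfulClass (p : ℕ) : Prop :=
  ∃ N : ℕ → Subgroup G, IsEtaSeries p N ∧ ∃ k : ℕ, N k = ⊤

end

end PowerfulClass

/-! Write `M = N 1`, so that `[M, G] ≤ M ^ p`, and let `M_i` be the iterated power series of `M`.
For odd `p`, taking `p`-th powers induces surjections `M_i / M_{i+1} → M_{i+1} / M_{i+2}`. If `M / M
^ p` is finite, these are eventually isomorphisms, and some `U = M_n` is torsion-free and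
centralized by every element of finite order.

Finiteness of `M / M ^ p` comes from showing that all closed subgroups of `G` are topologically
finitely generated (`closedNoetherian_of_isRelativeEtaSeries`), by induction on the length of the
series. Modulo `M ^ p` the subgroup `M` is central, so the commutator subgroups `[N (i + 1), G]`
form a shorter series.

A second induction (`exists_finite_subgroup_isOfFinOrder_mem`) treats torsion. Let `T` be the
subgroup generated by the elements of finite order. Its image in `G / M` is finite, so `U ∩ T` is
central of finite index in `T`. The transfer to the center shows that `T` is a torsion group, hence
`U ∩ T = 1` and `T` is finite. -/

namespace PowerfulClass

open Subgroup
open scoped commutatorElement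

/-! ### Commutators and `p`-th powers modulo a normal subgroup -/

section Algebra

variable {G : Type*} [Group G]

/-- The subgroup of elements that are central modulo `W`. -/
def centralMod (W : Subgroup G) [W.Normal] : Subgroup G :=
  (center (G ⧸ W)).comap (QuotientGroup.mk' W)

instance (W : Subgroup G) [W.Normal] : (centralMod W).Normal := by
  unfold centralMod; infer_instance

theorem mem_centralMod {W : Subgroup G} [W.Normal] {x : G} :
    x ∈ centralMod W ↔ ∀ g : G, ⁅x, g⁆ ∈ W := by
  rw [centralMod, mem_comap, mem_center_iff]
  refine ⟨fun h g => ?_, fun h g => ?_⟩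
  · rw [← QuotientGroup.eq_one_iff]
    have := h (g : G ⧸ W)
    change ((⁅x, g⁆ : G) : G ⧸ W) = 1
    rw [commutatorElement_def]
    simp only [QuotientGroup.mk_mul, QuotientGroup.mk_inv]
    rw [QuotientGroup.mk'_apply] at this
    rw [← this]; group
  · induction g using QuotientGroup.induction_on with
    | H g =>
      have := (QuotientGroup.eq_one_iff _).2 (h g)
      rw [commutatorElement_def] at this
      simp only [QuotientGroup.mk_mul, QuotientGroup.mk_inv] at this
      rw [mul_inv_eq_one, mul_inv_eq_iff_eq_mul] at this
      rw [QuotientGroup.mk'_apply, this]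

theorem commutator_top_le_iff {K W : Subgroup G} [W.Normal] :
    ⁅K, (⊤ : Subgroup G)⁆ ≤ W ↔ K ≤ centralMod W := by
  rw [commutator_le]
  exact ⟨fun h x hx => mem_centralMod.2 fun g => h x hx g trivial,
    fun h x hx g _ => mem_centralMod.1 (h hx) g⟩

theorem le_centralMod (W : Subgroup G) [W.Normal] : W ≤ centralMod W :=
  commutator_top_le_iff.1 (commutator_le_left _ _)

/-- Class-two collection: moving `c ^ i` past one `x` costs `z ^ i`, and `0 + 1 + ⋯ + (n - 1) =
n.choose 2`. -/
theorem mul_pow_of_commute {x c z : G} (h : c * x = x * c * z) (hx : Commute z x)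
    (hc : Commute z c) (n : ℕ) : (x * c) ^ n = x ^ n * c ^ n * z ^ (n.choose 2) := by
  have key : ∀ n : ℕ, c ^ n * x = x * c ^ n * z ^ n := by
    intro n
    induction n with
    | zero => simp
    | succ n ih =>
      rw [pow_succ, mul_assoc, h, mul_assoc x, ← mul_assoc, ih, mul_assoc (x * c ^ n),
        ← mul_assoc (z ^ n) c z, (hc.pow_left n).eq, pow_succ z n]
      simp only [mul_assoc]
  induction n with
  | zero => simp
  | succ n ih =>
    rw [pow_succ, ih, mul_assoc, ← mul_assoc _ x c, (hx.pow_left _).eq, mul_assoc x,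
      (hc.pow_left _).eq, mul_assoc, ← mul_assoc (c ^ n), key n, Nat.choose_succ_succ' n 1,
      Nat.choose_one_right]
    have e : z ^ n * c = c * z ^ n := (hc.pow_left n).eq
    calc x ^ n * (x * c ^ n * z ^ n * (c * z ^ n.choose 2))
        = x ^ n * x * c ^ n * (z ^ n * c) * z ^ n.choose 2 := by simp only [mul_assoc]
      _ = _ := by rw [e, pow_succ, pow_succ, pow_add]; simp only [mul_assoc]

/-- If `[c, x]` is central of exponent `p` modulo `W`, with `p` odd, then `x` and `c` satisfy
`(x c) ^ p = x ^ p c ^ p` modulo `W`. -/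
theorem mk_mul_pow {p : ℕ} (hp : p.Prime) (hp2 : p ≠ 2) {W : Subgroup G} [W.Normal] {x c : G}
    (hz : ⁅c⁻¹, x⁻¹⁆ ∈ centralMod W) (hzp : ⁅c⁻¹, x⁻¹⁆ ^ p ∈ W) :
    (((x * c) ^ p : G) : G ⧸ W) = (x ^ p : G) * (c ^ p : G) := by
  have hcen : ∀ g : G ⧸ W, Commute ((⁅c⁻¹, x⁻¹⁆ : G) : G ⧸ W) g := fun g =>
    (mem_center_iff.1 (mem_comap.1 hz) g).symm
  have h : (c : G ⧸ W) * x = x * c * (⁅c⁻¹, x⁻¹⁆ : G) := by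
    rw [commutatorElement_def]; simp only [QuotientGroup.mk_mul, QuotientGroup.mk_inv]; group
  -- Oddness of `p` enters here: `p` divides `p.choose 2`, which kills the correction term.
  obtain ⟨m, hm⟩ := hp.dvd_choose_self (k := 2) (by norm_num)
    (lt_of_le_of_ne hp.two_le (Ne.symm hp2))
  rw [QuotientGroup.mk_pow, QuotientGroup.mk_mul, mul_pow_of_commute h (hcen _) (hcen _), hm,
    pow_mul, ← QuotientGroup.mk_pow, ← QuotientGroup.mk_pow, ← QuotientGroup.mk_pow,
    (QuotientGroup.eq_one_iff _).2 hzp, one_pow, mul_one]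

/-- Since `g a g⁻¹ = a ⁅a⁻¹, g⁆`, `mk_mul_pow` shows that conjugation by `g` changes `a ^ p` by
`⁅a⁻¹, g⁆ ^ p`, which lies in `W`. -/
theorem pow_mem_centralMod {p : ℕ} (hp : p.Prime) (hp2 : p ≠ 2) {A W : Subgroup G} [A.Normal]
    [W.Normal] (hpow : ∀ c ∈ ⁅A, (⊤ : Subgroup G)⁆, c ^ p ∈ W)
    (hcomm : ⁅⁅⁅A, (⊤ : Subgroup G)⁆, (⊤ : Subgroup G)⁆, (⊤ : Subgroup G)⁆ ≤ W)
    {a : G} (ha : a ∈ A) : a ^ p ∈ centralMod W := by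
  have key : ∀ g : G, ((g * a * g⁻¹) ^ p : G) = ((a ^ p : G) : G ⧸ W) := by
    intro g
    have hc : ⁅a⁻¹, g⁆ ∈ ⁅A, (⊤ : Subgroup G)⁆ := commutator_mem_commutator (inv_mem ha) trivial
    have hz : ⁅⁅a⁻¹, g⁆⁻¹, a⁻¹⁆ ∈ ⁅⁅A, (⊤ : Subgroup G)⁆, (⊤ : Subgroup G)⁆ :=
      commutator_mem_commutator (inv_mem hc) trivial
    have := mk_mul_pow hp hp2 (commutator_top_le_iff.1 hcomm hz)
      (hpow _ (commutator_mono (commutator_le_left _ _) le_rfl hz))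
    rw [(QuotientGroup.eq_one_iff _).2 (hpow _ hc), mul_one] at this
    rw [← this]
    congr 2
    rw [commutatorElement_def]; group
  rw [centralMod, mem_comap, mem_center_iff]
  intro g
  induction g using QuotientGroup.induction_on with
  | H g =>
    have := key g
    rw [conj_pow, QuotientGroup.mk_mul, QuotientGroup.mk_mul, QuotientGroup.mk_inv,
      mul_inv_eq_iff_eq_mul] at this
    exact this

end Algebra

/-! ### Closed subgroups and powerful embedding in pro-`p` groups -/

section Topology

variable {G : Type*} [Group G] [TopologicalSpace G] [IsTopologicalGroup G]

theorem isClosed_centralMod {W : Subgroup G} [W.Normal] (hW : IsClosed (W : Set G)) :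
    IsClosed (centralMod W : Set G) := by
  have : (centralMod W : Set G) = ⋂ g : G, (fun x => ⁅x, g⁆) ⁻¹' (W : Set G) := by
    ext x; simp [mem_centralMod]
  rw [this]
  refine isClosed_iInter fun g => hW.preimage ?_
  simp only [commutatorElement_def]
  fun_prop

theorem isClosed_powSubgroup (p : ℕ) (N : Subgroup G) : IsClosed (powSubgroup p N : Set G) :=
  isClosed_topologicalClosure _

theorem pow_mem_powSubgroup {p : ℕ} {N : Subgroup G} {x : G} (hx : x ∈ N) :
    x ^ p ∈ powSubgroup p N :=
  le_topologicalClosure _ (subset_closure ⟨x, hx, rfl⟩)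

theorem powSubgroup_le {p : ℕ} {N W : Subgroup G} (hW : IsClosed (W : Set G))
    (h : ∀ x ∈ N, x ^ p ∈ W) : powSubgroup p N ≤ W :=
  topologicalClosure_minimal _ (by rw [closure_le]; rintro _ ⟨x, hx, rfl⟩; exact h x hx) hW

theorem powSubgroup_le_self {p : ℕ} {N : Subgroup G} (hN : IsClosed (N : Set G)) :
    powSubgroup p N ≤ N :=
  powSubgroup_le hN fun _ hx => pow_mem hx p

instance powSubgroup_normal (p : ℕ) (N : Subgroup G) [hN : N.Normal] :
    (powSubgroup p N).Normal := by
  have : (Subgroup.closure {y : G | ∃ x ∈ N, y = x ^ p}).Normal := by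
    refine ⟨fun n hn g => ?_⟩
    induction hn using closure_induction with
    | mem y hy =>
      obtain ⟨x, hx, rfl⟩ := hy
      exact subset_closure ⟨g * x * g⁻¹, hN.conj_mem x hx g, by rw [conj_pow]⟩
    | one => simp
    | mul a b _ _ ha hb =>
      have : g * (a * b) * g⁻¹ = (g * a * g⁻¹) * (g * b * g⁻¹) := by group
      rw [this]; exact mul_mem ha hb
    | inv a _ ha =>
      have : g * a⁻¹ * g⁻¹ = (g * a * g⁻¹)⁻¹ := by group
      rw [this]; exact inv_mem ha
  exact is_normal_topologicalClosure _

instance topologicalClosure_normal (N : Subgroup G) [N.Normal] : N.topologicalClosure.Normal :=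
  is_normal_topologicalClosure _

theorem isClosed_sup [CompactSpace G] [T2Space G] {A N : Subgroup G} [N.Normal]
    (hA : IsClosed (A : Set G)) (hN : IsClosed (N : Set G)) :
    IsClosed ((A ⊔ N : Subgroup G) : Set G) := by
  rw [mul_normal]
  exact (hA.isCompact.mul hN.isCompact).isClosed

theorem mem_of_forall_mem_sup_openNormalSubgroup [CompactSpace G] [TotallyDisconnectedSpace G]
    {D : Subgroup G} (hD : IsClosed (D : Set G)) {x : G}
    (h : ∀ V : OpenNormalSubgroup G, x ∈ D ⊔ (V : Subgroup G)) : x ∈ D := by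
  by_contra hx
  obtain ⟨V, hV⟩ := ProfiniteGrp.exist_openNormalSubgroup_sub_open_nhds_of_one
    (G := G) (U := (fun y => x * y) ⁻¹' (D : Set G)ᶜ)
    (hD.isOpen_compl.preimage (by fun_prop)) (by simpa using hx)
  obtain ⟨d, hd, v, hv, rfl⟩ := mem_sup_of_normal_right.1 (h V)
  exact hV (inv_mem hv) (by simpa using hd)

theorem topologicalClosure_le_sup_open (X : Subgroup G) {V : Subgroup G} (hV : IsOpen (V : Set G)) :
    X.topologicalClosure ≤ X ⊔ V :=
  topologicalClosure_minimal _ le_sup_left (isClosed_of_isOpen _ (isOpen_mono le_sup_right hV))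

theorem IsProPGroup.isPGroup_quotient {p : ℕ} (hG : IsProPGroup p G) (V : OpenNormalSubgroup G) :
    Finite (G ⧸ (V : Subgroup G)) ∧ IsPGroup p (G ⧸ (V : Subgroup G)) := by
  have := hG.compactSpace
  refine ⟨Subgroup.quotient_finite_of_isOpen _ V.isOpen, ?_⟩
  obtain ⟨n, hn⟩ := hG.index_eq_pow (V : Subgroup G) inferInstance V.isOpen
  exact IsPGroup.of_card (n := n) hn

/-- A closed normal subgroup `W` contains any `K` with `K ≤ W [K, G]`. -/
theorem IsProPGroup.le_of_le_sup_commutator {p : ℕ} (hp : p.Prime) (hG : IsProPGroup p G)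
    {K W : Subgroup G} [W.Normal] (hW : IsClosed (W : Set G))
    (h : K ≤ (W ⊔ ⁅K, (⊤ : Subgroup G)⁆).topologicalClosure) : K ≤ W := by
  have := hG.compactSpace
  have := hG.totallyDisconnectedSpace
  have : Fact p.Prime := ⟨hp⟩
  intro x hx
  refine mem_of_forall_mem_sup_openNormalSubgroup hW fun V => ?_
  obtain ⟨hfin, hpg⟩ := hG.isPGroup_quotient V
  obtain ⟨n, hn⟩ := Subgroup.nilpotent_iff_lowerCentralSeries.1 hpg.isNilpotent
  have hnV : Subgroup.lowerCentralSeries (⊤ : Subgroup G) n ≤ V := by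
    rw [← map_top_of_surjective _ (QuotientGroup.mk'_surjective (V : Subgroup G)),
      ← map_lowerCentralSeries, Subgroup.map_eq_bot_iff, QuotientGroup.ker_mk'] at hn
    exact hn
  have hK : K ≤ (W ⊔ V) ⊔ ⁅K, (⊤ : Subgroup G)⁆ := by
    refine h.trans ((topologicalClosure_le_sup_open _ V.isOpen).trans ?_)
    rw [sup_right_comm]
  -- Feeding the inclusion `K ≤ W V [K, G]` into itself descends the lower central series, which
  -- ends inside `V` because the finite `p`-group `G / V` is nilpotent.
  have step : ∀ m, K ≤ (W ⊔ V) ⊔ Subgroup.lowerCentralSeries (⊤ : Subgroup G) m := by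
    intro m
    induction m with
    | zero => simp
    | succ m ih =>
      refine hK.trans (sup_le le_sup_left ?_)
      rw [commutator_top_le_iff]
      refine ih.trans (sup_le ?_ ?_)
      · exact le_sup_left.trans (le_centralMod _)
      · rw [← commutator_top_le_iff]
        exact le_sup_right
  exact (step n).trans (sup_le le_rfl (hnV.trans le_sup_right)) hx

theorem commutator_powSubgroup_le_aux {p : ℕ} (hp : p.Prime) (hp2 : p ≠ 2) {A W : Subgroup G}
    [A.Normal] [W.Normal] (hW : IsClosed (W : Set G))
    (hpow : ∀ c ∈ ⁅A, (⊤ : Subgroup G)⁆, c ^ p ∈ W)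
    (hcomm : ⁅⁅⁅A, (⊤ : Subgroup G)⁆, (⊤ : Subgroup G)⁆, (⊤ : Subgroup G)⁆ ≤ W) :
    powSubgroup p A ≤ centralMod W :=
  powSubgroup_le (isClosed_centralMod hW) fun _ ha => pow_mem_centralMod hp hp2 hpow hcomm ha

/-- If `N` is powerfully embedded in `G`, then so is `N ^ p`. -/
theorem IsProPGroup.commutator_powSubgroup_le {p : ℕ} (hp : p.Prime) (hp2 : p ≠ 2)
    (hG : IsProPGroup p G) {N : Subgroup G} [N.Normal]
    (h : ⁅N, (⊤ : Subgroup G)⁆ ≤ powSubgroup p N) :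
    ⁅powSubgroup p N, (⊤ : Subgroup G)⁆ ≤ powSubgroup p (powSubgroup p N) := by
  -- This allows one further commutator with `G` to be absorbed into the target, which supplies the
  -- triple-commutator hypothesis of the auxiliary lemma.
  refine hG.le_of_le_sup_commutator hp (isClosed_powSubgroup _ _) ?_
  rw [commutator_top_le_iff]
  refine commutator_powSubgroup_le_aux hp hp2 (isClosed_topologicalClosure _)
    (fun c hc => le_topologicalClosure _ (mem_sup_left (pow_mem_powSubgroup (h hc)))) ?_
  exact (commutator_mono (commutator_mono h le_rfl) le_rfl).trans
    (le_sup_right.trans (le_topologicalClosure _))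

/-- If `A / B` is powerfully embedded in `G / B`, then `[A, G] / [B, G]` is powerfully embedded in
`G / [B, G]`. -/
theorem IsProPGroup.commutator_commutator_le {p : ℕ} (hp : p.Prime) (hp2 : p ≠ 2)
    (hG : IsProPGroup p G) {A B : Subgroup G} [A.Normal] [B.Normal] (hB : IsClosed (B : Set G))
    (h : ⁅A, (⊤ : Subgroup G)⁆ ≤ powSubgroup p A ⊔ B) :
    ⁅⁅A, (⊤ : Subgroup G)⁆.topologicalClosure, (⊤ : Subgroup G)⁆ ≤
      powSubgroup p ⁅A, (⊤ : Subgroup G)⁆.topologicalClosure ⊔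
        ⁅B, (⊤ : Subgroup G)⁆.topologicalClosure := by
  have := hG.compactSpace
  have := hG.t2Space
  set K := ⁅A, (⊤ : Subgroup G)⁆.topologicalClosure
  set K₀ := ⁅B, (⊤ : Subgroup G)⁆.topologicalClosure
  have hAK : ⁅A, (⊤ : Subgroup G)⁆ ≤ K := le_topologicalClosure _
  have hW : IsClosed ((powSubgroup p K ⊔ K₀ : Subgroup G) : Set G) :=
    isClosed_sup (isClosed_powSubgroup _ _) (isClosed_topologicalClosure _)
  refine hG.le_of_le_sup_commutator hp hW ?_
  set W := (powSubgroup p K ⊔ K₀ ⊔ ⁅⁅K, (⊤ : Subgroup G)⁆, (⊤ : Subgroup G)⁆).topologicalClosure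
  have hWW : powSubgroup p K ⊔ K₀ ≤ W := le_sup_left.trans (le_topologicalClosure _)
  have hKAB : K ≤ powSubgroup p A ⊔ B :=
    topologicalClosure_minimal _ h (isClosed_sup (isClosed_powSubgroup _ _) hB)
  rw [commutator_top_le_iff]
  -- The factor `A ^ p` is central modulo `W` by the power calculation, and the factor `B` because
  -- `[B, G] ≤ K₀`.
  refine hKAB.trans (sup_le ?_ ?_)
  · refine commutator_powSubgroup_le_aux hp hp2 (isClosed_topologicalClosure _)
      (fun c hc => hWW (mem_sup_left (pow_mem_powSubgroup (hAK hc)))) ?_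
    exact (commutator_mono (commutator_mono hAK le_rfl) le_rfl).trans
      (le_sup_right.trans (le_topologicalClosure _))
  · rw [← commutator_top_le_iff]
    exact (le_topologicalClosure _).trans (le_sup_right.trans hWW)

end Topology

/-! ### Topological finite generation, quotients and extensions -/

section Homomorphisms

variable {G H : Type*} [Group G] [TopologicalSpace G] [Group H] [TopologicalSpace H]

theorem isClosed_map [CompactSpace G] [T2Space H] {f : G →* H} (hf : Continuous f)
    {A : Subgroup G} (hA : IsClosed (A : Set G)) : IsClosed (A.map f : Set H) :=
  (hA.isCompact.image hf).isClosed

/-- A finite set generates `R` as a closed normal subgroup. -/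
def ClosedNormallyFG (R : Subgroup G) : Prop :=
  ∃ S : Set G, S.Finite ∧ S ⊆ R ∧
    ∀ L : Subgroup G, L.Normal → IsClosed (L : Set G) → S ⊆ L → R ≤ L

theorem ClosedNormallyFG.map {f : G →* H} (hf : Continuous f) {R : Subgroup G}
    (hR : ClosedNormallyFG R) : ClosedNormallyFG (R.map f) := by
  obtain ⟨S, hS, hSR, h⟩ := hR
  refine ⟨f '' S, hS.image f, Set.image_mono hSR, fun L hL hLc hSL => ?_⟩
  rw [map_le_iff_le_comap]
  exact h _ inferInstance (hLc.preimage hf) fun x hx => hSL ⟨x, hx, rfl⟩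

end Homomorphisms

section Quotients

variable {G : Type*} [Group G] [TopologicalSpace G] [IsTopologicalGroup G]
variable {H : Type*} [Group H] [TopologicalSpace H] [IsTopologicalGroup H]

theorem map_powSubgroup [CompactSpace G] [T2Space H] {f : G →* H} (hf : Continuous f) (p : ℕ)
    (N : Subgroup G) : (powSubgroup p N).map f = powSubgroup p (N.map f) := by
  apply le_antisymm
  · rw [map_le_iff_le_comap]
    refine powSubgroup_le ((isClosed_powSubgroup p (N.map f)).preimage hf) fun x hx => ?_
    rw [mem_comap, map_pow]
    exact pow_mem_powSubgroup (mem_map_of_mem f hx)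
  · refine powSubgroup_le (isClosed_map hf (isClosed_powSubgroup p N)) ?_
    rintro _ ⟨x, hx, rfl⟩
    exact ⟨x ^ p, pow_mem_powSubgroup hx, map_pow f x p⟩

theorem IsProPGroup.quotient {p : ℕ} (hG : IsProPGroup p G) {N : Subgroup G} [N.Normal]
    (hN : IsClosed (N : Set G)) : IsProPGroup p (G ⧸ N) := by
  have := hG.compactSpace
  have := hG.t2Space
  have := hG.totallyDisconnectedSpace
  have : IsClosed (N : Set G) := hN
  refine ⟨inferInstance, inferInstance, inferInstance, ?_, fun U hU hUo => ?_⟩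
  · have : TotallySeparatedSpace (G ⧸ N) := by
      rw [totallySeparatedSpace_iff_exists_isClopen]
      intro x y hxy
      induction x using QuotientGroup.induction_on with | H x => ?_
      induction y using QuotientGroup.induction_on with | H y => ?_
      have hxy' : x⁻¹ * y ∉ N := fun h => hxy (QuotientGroup.eq.2 h)
      have : ∃ V : OpenNormalSubgroup G, x⁻¹ * y ∉ N ⊔ (V : Subgroup G) := by
        by_contra! h
        exact hxy' (mem_of_forall_mem_sup_openNormalSubgroup hN h)
      obtain ⟨V, hV⟩ := this
      have hUo : IsOpen ((V : Subgroup G).map (QuotientGroup.mk' N) : Set (G ⧸ N)) :=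
        QuotientGroup.isOpenMap_coe _ V.isOpen
      refine ⟨(fun z => (x : G ⧸ N)⁻¹ * z) ⁻¹' ((V : Subgroup G).map (QuotientGroup.mk' N)),
        ⟨(isClosed_of_isOpen _ hUo).preimage (by fun_prop), hUo.preimage (by fun_prop)⟩,
        by simpa using ⟨1, one_mem _, one_mem _⟩, ?_⟩
      rw [Set.mem_compl_iff, Set.mem_preimage, SetLike.mem_coe, ← QuotientGroup.mk_inv,
        ← QuotientGroup.mk_mul]
      intro h
      apply hV
      have := mem_comap (f := QuotientGroup.mk' N).2 h
      rwa [comap_map_eq, QuotientGroup.ker_mk', sup_comm] at this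
    infer_instance
  · obtain ⟨n, hn⟩ := hG.index_eq_pow (U.comap (QuotientGroup.mk' N)) inferInstance
      (hUo.preimage QuotientGroup.continuous_mk)
    exact ⟨n, by rw [← hn, index_comap_of_surjective _ (QuotientGroup.mk'_surjective N)]⟩

/-- A subgroup that is topologically generated by a finite set. -/
def ClosedFG (A : Subgroup G) : Prop :=
  ∃ S : Set G, S.Finite ∧ (Subgroup.closure S).topologicalClosure = A

/-- A subgroup all of whose closed subgroups are topologically finitely generated. -/
def ClosedNoetherian (R : Subgroup G) : Prop :=
  ∀ A ≤ R, IsClosed (A : Set G) → ClosedFG A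

theorem ClosedNoetherian.mono {R R' : Subgroup G} (h : ClosedNoetherian R') (hR : R ≤ R') :
    ClosedNoetherian R :=
  fun A hA => h A (hA.trans hR)

theorem ClosedFG.map [CompactSpace G] [T2Space H] {f : G →* H} (hf : Continuous f)
    {A : Subgroup G} (hA : ClosedFG A) : ClosedFG (A.map f) := by
  obtain ⟨S, hS, rfl⟩ := hA
  refine ⟨f '' S, hS.image f, le_antisymm ?_ ?_⟩
  · refine topologicalClosure_minimal _ ?_ (isClosed_map hf (isClosed_topologicalClosure _))
    rw [← MonoidHom.map_closure]
    exact map_mono (le_topologicalClosure _)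
  · rw [map_le_iff_le_comap]
    refine topologicalClosure_minimal _ ?_ ((isClosed_topologicalClosure _).preimage hf)
    rw [← map_le_iff_le_comap, MonoidHom.map_closure]
    exact le_topologicalClosure _

theorem ClosedNoetherian.map [CompactSpace G] [T2Space H] {f : G →* H} (hf : Continuous f)
    {R : Subgroup G} (hRc : IsClosed (R : Set G)) (hR : ClosedNoetherian R) :
    ClosedNoetherian (R.map f) := by
  intro A hA hAc
  have : A = (R ⊓ A.comap f).map f := by
    ext y
    refine ⟨fun hy => ?_, ?_⟩
    · obtain ⟨x, hx, rfl⟩ := hA hy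
      exact ⟨x, ⟨hx, hy⟩, rfl⟩
    · rintro ⟨x, ⟨_, hx⟩, rfl⟩
      exact hx
  rw [this]
  exact (hR _ inf_le_left (hRc.inter (hAc.preimage hf))).map hf

theorem ClosedFG.of_le {A B : Subgroup G} (hA : IsClosed (A : Set G)) (hBA : B ≤ A)
    (hB : ClosedFG B) {F : Set G} (hF : F.Finite) (hFA : F ⊆ A)
    (h : ∀ D : Subgroup G, IsClosed (D : Set G) → D ≤ A → B ≤ D → F ⊆ D → A ≤ D) :
    ClosedFG A := by
  obtain ⟨S, hS, rfl⟩ := hB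
  have hSA : S ⊆ A := fun x hx => hBA (le_topologicalClosure _ (subset_closure hx))
  have hle : (Subgroup.closure (S ∪ F)).topologicalClosure ≤ A :=
    topologicalClosure_minimal _ ((closure_le _).2 (Set.union_subset hSA hFA)) hA
  refine ⟨S ∪ F, hS.union hF, le_antisymm hle (h _ (isClosed_topologicalClosure _) hle ?_ ?_)⟩
  · exact topologicalClosure_mono (closure_mono Set.subset_union_left)
  · exact fun x hx => le_topologicalClosure _ (subset_closure (Or.inr hx))

theorem ClosedFG.of_relIndex_ne_zero {A B : Subgroup G} (hA : IsClosed (A : Set G)) (hBA : B ≤ A)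
    (hB : ClosedFG B) (h : B.relIndex A ≠ 0) : ClosedFG A := by
  have : Finite (A ⧸ B.subgroupOf A) := by
    have : (B.subgroupOf A).FiniteIndex := ⟨h⟩
    exact finite_quotient_of_finiteIndex
  refine ClosedFG.of_le hA hBA hB
    (F := Set.range fun q : A ⧸ B.subgroupOf A => ((Quotient.out q : A) : G))
    (Set.finite_range _) ?_ ?_
  · rintro _ ⟨q, rfl⟩
    exact (Quotient.out q).2
  · intro D _ _ hBD hFD a ha
    have h1 := QuotientGroup.eq.1 (Quotient.out_eq (QuotientGroup.mk (s := B.subgroupOf A) ⟨a, ha⟩))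
    have h2 := hFD ⟨QuotientGroup.mk (s := B.subgroupOf A) ⟨a, ha⟩, rfl⟩
    have h3 := hBD (mem_subgroupOf.1 h1)
    have := mul_mem h2 h3
    simpa using this

/-- Extensions of groups with topologically finitely generated closed subgroups. -/
theorem ClosedNoetherian.of_quotient [CompactSpace G] [T2Space G] {M R : Subgroup G} [M.Normal]
    (hM : IsClosed (M : Set G)) (hMN : ClosedNoetherian M)
    (hR : ClosedNoetherian (R.map (QuotientGroup.mk' M))) : ClosedNoetherian R := by
  have : IsClosed (M : Set G) := hM
  have hcont : Continuous (QuotientGroup.mk' M) := QuotientGroup.continuous_mk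
  intro A hAR hA
  obtain ⟨S, hS, hSA⟩ := hR (A.map (QuotientGroup.mk' M)) (map_mono hAR) (isClosed_map hcont hA)
  have hS' : S ⊆ QuotientGroup.mk' M '' A := fun x hx => by
    have : x ∈ A.map (QuotientGroup.mk' M) := hSA ▸ le_topologicalClosure _ (subset_closure hx)
    exact this
  obtain ⟨F, hFA, hF, hSA⟩ := (Set.exists_subset_image_finite_and (p := fun S =>
    (Subgroup.closure S).topologicalClosure = A.map (QuotientGroup.mk' M))).1 ⟨S, hS', hS, hSA⟩
  refine ClosedFG.of_le hA inf_le_left (hMN (A ⊓ M) inf_le_right (hA.inter hM)) hF hFA ?_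
  intro D hD hDA hMD hFD a ha
  have h1 : A.map (QuotientGroup.mk' M) ≤ D.map (QuotientGroup.mk' M) := by
    rw [← hSA]
    refine topologicalClosure_minimal _ ((closure_le _).2 ?_) (isClosed_map hcont hD)
    rintro _ ⟨x, hx, rfl⟩
    exact ⟨x, hFD hx, rfl⟩
  obtain ⟨d, hd, hda⟩ := h1 (mem_map_of_mem _ ha)
  have h2 : d⁻¹ * a ∈ M := QuotientGroup.eq.1 hda
  have := mul_mem hd (hMD ⟨A.mul_mem (A.inv_mem (hDA hd)) ha, h2⟩)
  simpa using this

/-- `N / N ^ p` is abelian of exponent `p`. The abstract subgroup generated by finitely many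
topological generators is therefore finite, hence closed, hence everything. -/
theorem relIndex_powSubgroup_ne_zero [CompactSpace G] [T2Space G] {p : ℕ} (hp : p.Prime)
    {N : Subgroup G} [N.Normal]
    (h : ⁅N, (⊤ : Subgroup G)⁆ ≤ powSubgroup p N) (hfg : ClosedFG N) :
    (powSubgroup p N).relIndex N ≠ 0 := by
  have : IsClosed (powSubgroup p N : Set G) := isClosed_powSubgroup p N
  obtain ⟨S, hS, hSN⟩ := hfg.map (f := QuotientGroup.mk' (powSubgroup p N))
    QuotientGroup.continuous_mk
  have hSsub : ∀ x ∈ Subgroup.closure S, x ∈ N.map (QuotientGroup.mk' (powSubgroup p N)) :=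
    fun x hx => hSN ▸ le_topologicalClosure _ hx
  have hcomm : ∀ x ∈ S, ∀ y ∈ S, x * y = y * x := by
    intro x hx y _
    obtain ⟨a, ha, rfl⟩ := hSsub x (subset_closure hx)
    exact (mem_center_iff.1 (mem_comap.1 (commutator_top_le_iff.1 h ha)) y).symm
  have htors : ∀ x ∈ Subgroup.closure S, x ^ p = 1 := by
    intro x hx
    obtain ⟨a, ha, rfl⟩ := hSsub x hx
    exact (QuotientGroup.eq_one_iff _).2 (pow_mem_powSubgroup ha)
  have hfin : Finite (Subgroup.closure S) := by
    have := hS.to_subtype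
    let _ : CommGroup (Subgroup.closure S) :=
      { (inferInstance : Group (Subgroup.closure S)) with
        mul_comm := (isMulCommutative_closure hcomm).is_comm.comm }
    exact CommGroup.finite_of_fg_isMulTorsion (G := Subgroup.closure S) fun x =>
      isOfFinOrder_iff_pow_eq_one.2 ⟨p, hp.pos, Subtype.ext (htors x x.2)⟩
  have hcl : IsClosed (Subgroup.closure S : Set (G ⧸ powSubgroup p N)) :=
    (Set.toFinite _).isClosed
  have hle : N.map (QuotientGroup.mk' (powSubgroup p N)) ≤ Subgroup.closure S := by
    rw [← hSN]; exact topologicalClosure_minimal _ le_rfl hcl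
  have hfin' : Finite (N.map (QuotientGroup.mk' (powSubgroup p N))) :=
    Finite.of_injective _ (inclusion_injective hle)
  have := relIndex_ker N (QuotientGroup.mk' (powSubgroup p N))
  rw [QuotientGroup.ker_mk'] at this
  rw [this]
  exact Nat.card_pos.ne'

end Quotients

/-! ### The power series of a powerfully embedded subgroup -/

theorem exists_eq_of_antitone {a : ℕ → ℕ} (ha : ∀ i, a (i + 1) ≤ a i) :
    ∃ n, ∀ m, n ≤ m → a m = a n := by
  obtain ⟨n, hn⟩ := WellFoundedGT.monotone_chain_condition (α := ℕᵒᵈ)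
    ⟨fun i => OrderDual.toDual (a i), monotone_nat_of_le_succ fun i => ha i⟩
  exact ⟨n, fun m hm => (OrderDual.toDual.injective (hn m hm)).symm⟩

/-- A nontrivial finite `p`-group has a normal subgroup of index `p`, and this contains all `p`-th
powers. -/
theorem IsPGroup.eq_bot_of_le_closure_pow {G : Type*} [Group G] {p : ℕ} (hp : p.Prime)
    [Finite G] (hG : IsPGroup p G) {Q : Subgroup G}
    (h : Q ≤ Subgroup.closure {y : G | ∃ x ∈ Q, y = x ^ p}) : Q = ⊥ := by
  have : Fact p.Prime := ⟨hp⟩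
  by_contra hQ
  have : Nontrivial Q := (nontrivial_iff_ne_bot Q).2 hQ
  obtain ⟨n, hn, hcard⟩ := (hG.to_subgroup Q).nontrivial_iff_card.1 this
  obtain ⟨K, hK⟩ := Sylow.exists_subgroup_card_pow_prime (G := Q) p (n := n - 1)
    (by rw [hcard]; exact pow_dvd_pow p (Nat.sub_le n 1))
  have hidx : K.index = p := by
    have := K.card_mul_index
    rw [hK, hcard] at this
    obtain ⟨m, rfl⟩ : ∃ m, n = m + 1 := ⟨n - 1, by omega⟩
    rw [Nat.add_sub_cancel, pow_succ] at this
    exact Nat.eq_of_mul_eq_mul_left (pow_pos hp.pos m) this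
  have hKn : K.Normal := normal_of_index_eq_minFac_card (by
    rw [hidx, hcard, hp.pow_minFac hn.ne'])
  have hle : Q ≤ K.map Q.subtype := by
    refine h.trans ((closure_le _).2 ?_)
    rintro _ ⟨x, hx, rfl⟩
    have := K.pow_index_mem (⟨x, hx⟩ : Q)
    rw [hidx] at this
    exact ⟨_, this, rfl⟩
  have : K = ⊤ := by
    rw [eq_top_iff]
    intro x _
    obtain ⟨y, hy, hyx⟩ := hle x.2
    rwa [← Subtype.ext (a1 := y) hyx]
  rw [this, index_top] at hidx
  exact hp.one_lt.ne hidx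

section

variable {G : Type*} [Group G] [TopologicalSpace G] [IsTopologicalGroup G]

/-- The series `N`, `N ^ p`, `(N ^ p) ^ p`, … -/
def powSeries (p : ℕ) (N : Subgroup G) : ℕ → Subgroup G
  | 0 => N
  | i + 1 => powSubgroup p (powSeries p N i)

instance powSeries_normal (p : ℕ) (N : Subgroup G) [N.Normal] (i : ℕ) :
    (powSeries p N i).Normal := by
  induction i with
  | zero => assumption
  | succ i ih => exact powSubgroup_normal p _

theorem isClosed_powSeries {p : ℕ} {N : Subgroup G} (hN : IsClosed (N : Set G)) (i : ℕ) :
    IsClosed (powSeries p N i : Set G) := by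
  cases i with
  | zero => exact hN
  | succ i => exact isClosed_powSubgroup p _

theorem powSeries_antitone {p : ℕ} {N : Subgroup G} (hN : IsClosed (N : Set G)) :
    Antitone (powSeries p N) :=
  antitone_nat_of_succ_le fun i => powSubgroup_le_self (isClosed_powSeries hN i)

theorem pow_mem_powSeries {p : ℕ} {N : Subgroup G} {i : ℕ} {x : G} (hx : x ∈ powSeries p N i) :
    x ^ p ∈ powSeries p N (i + 1) :=
  pow_mem_powSubgroup hx

theorem IsProPGroup.commutator_powSeries_le {p : ℕ} (hp : p.Prime) (hp2 : p ≠ 2)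
    (hG : IsProPGroup p G) {N : Subgroup G} [N.Normal]
    (h : ⁅N, (⊤ : Subgroup G)⁆ ≤ powSubgroup p N) (i : ℕ) :
    ⁅powSeries p N i, (⊤ : Subgroup G)⁆ ≤ powSeries p N (i + 1) := by
  induction i with
  | zero => exact h
  | succ i ih => exact hG.commutator_powSubgroup_le hp hp2 ih

/-- In the finite group `G / V` the images of the series stabilize, and a stable image is generated
by its own `p`-th powers. -/
theorem IsProPGroup.exists_powSeries_le {p : ℕ} (hp : p.Prime) (hG : IsProPGroup p G)
    {N : Subgroup G} (hN : IsClosed (N : Set G)) (V : OpenNormalSubgroup G) :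
    ∃ i, powSeries p N i ≤ V := by
  obtain ⟨hfin, hpg⟩ := hG.isPGroup_quotient V
  set f := QuotientGroup.mk' (V : Subgroup G)
  obtain ⟨n, hn⟩ := WellFoundedGT.monotone_chain_condition
    (α := (Subgroup (G ⧸ (V : Subgroup G)))ᵒᵈ)
    ⟨fun i => OrderDual.toDual ((powSeries p N i).map f),
      fun i j hij => map_mono (powSeries_antitone hN hij)⟩
  have hn' : (powSeries p N n).map f = (powSeries p N (n + 1)).map f :=
    OrderDual.toDual.injective (hn (n + 1) (Nat.le_succ n))
  refine ⟨n, ?_⟩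
  have hker : f.ker = V := QuotientGroup.ker_mk' _
  rw [← hker, ← Subgroup.map_eq_bot_iff]
  refine IsPGroup.eq_bot_of_le_closure_pow hp hpg (hn'.le.trans ?_)
  refine (map_mono (topologicalClosure_le_sup_open _ V.isOpen)).trans ?_
  rw [Subgroup.map_sup, (Subgroup.map_eq_bot_iff _).2 hker.ge, sup_bot_eq, MonoidHom.map_closure]
  apply Subgroup.closure_mono
  rintro _ ⟨_, ⟨x, hx, rfl⟩, rfl⟩
  exact ⟨f x, mem_map_of_mem f hx, map_pow f x p⟩

theorem IsProPGroup.eq_one_of_mem_powSeries {p : ℕ} (hp : p.Prime) (hG : IsProPGroup p G)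
    {N : Subgroup G} (hN : IsClosed (N : Set G)) {x : G} (hx : ∀ i, x ∈ powSeries p N i) :
    x = 1 := by
  have := hG.compactSpace
  have := hG.t2Space
  have := hG.totallyDisconnectedSpace
  rw [← mem_bot]
  refine mem_of_forall_mem_sup_openNormalSubgroup (by simp) fun V => ?_
  obtain ⟨i, hi⟩ := hG.exists_powSeries_le hp hN V
  exact mem_sup_right (hi (hx i))

/-- Only `c` has to lie in the series. Arbitrary `g` is needed later, for torsion elements outside
`N`. -/
theorem IsProPGroup.mk_mul_pow_powSeries {p : ℕ} (hp : p.Prime) (hp2 : p ≠ 2)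
    (hG : IsProPGroup p G) {N : Subgroup G} [N.Normal]
    (h : ⁅N, (⊤ : Subgroup G)⁆ ≤ powSubgroup p N) {i : ℕ} {g c : G}
    (hc : c ∈ powSeries p N i) :
    (((g * c) ^ p : G) : G ⧸ powSeries p N (i + 2)) = (g ^ p : G) * (c ^ p : G) := by
  have hz : ⁅c⁻¹, g⁻¹⁆ ∈ powSeries p N (i + 1) :=
    hG.commutator_powSeries_le hp hp2 h i (commutator_mem_commutator (inv_mem hc) (mem_top _))
  exact mk_mul_pow hp hp2
    (commutator_top_le_iff.1 (hG.commutator_powSeries_le hp hp2 h (i + 1)) hz)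
    (pow_mem_powSeries hz)

/-- The `p`-th power homomorphism from the `i`-th term of the power series of a powerfully embedded
subgroup. -/
def IsProPGroup.powHom {p : ℕ} (hp : p.Prime) (hp2 : p ≠ 2)
    (hG : IsProPGroup p G) {N : Subgroup G} [N.Normal]
    (h : ⁅N, (⊤ : Subgroup G)⁆ ≤ powSubgroup p N) (i : ℕ) :
    powSeries p N i →* G ⧸ powSeries p N (i + 2) where
  toFun x := ((x : G) ^ p : G)
  map_one' := by simp
  map_mul' x y := hG.mk_mul_pow_powSeries hp hp2 h y.2

/-- The `p`-th powers generate the next term only topologically, but the range is a compact image,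
hence already closed. -/
theorem IsProPGroup.range_powHom {p : ℕ} (hp : p.Prime) (hp2 : p ≠ 2)
    (hG : IsProPGroup p G) {N : Subgroup G} [N.Normal] (hN : IsClosed (N : Set G))
    (h : ⁅N, (⊤ : Subgroup G)⁆ ≤ powSubgroup p N) (i : ℕ) :
    (hG.powHom hp hp2 h i).range =
      (powSeries p N (i + 1)).map (QuotientGroup.mk' (powSeries p N (i + 2))) := by
  have := hG.compactSpace
  have hcl : IsClosed (powSeries p N (i + 2) : Set G) := isClosed_powSeries hN _
  apply le_antisymm
  · rintro _ ⟨x, rfl⟩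
    exact ⟨_, pow_mem_powSeries x.2, rfl⟩
  · have himage : ((hG.powHom hp hp2 h i).range : Set (G ⧸ powSeries p N (i + 2))) =
        (fun x : G => ((x ^ p : G) : G ⧸ powSeries p N (i + 2))) '' (powSeries p N i) := by
      ext y
      constructor
      · rintro ⟨x, rfl⟩
        exact ⟨x, x.2, rfl⟩
      · rintro ⟨x, hx, rfl⟩
        exact ⟨⟨x, hx⟩, rfl⟩
    have hclosed : IsClosed ((hG.powHom hp hp2 h i).range : Set (G ⧸ powSeries p N (i + 2))) := by
      rw [himage]
      exact ((isClosed_powSeries hN i).isCompact.image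
        (QuotientGroup.continuous_mk.comp (continuous_pow p))).isClosed
    have hpre : IsClosed (((hG.powHom hp hp2 h i).range.comap
        (QuotientGroup.mk' (powSeries p N (i + 2))) : Subgroup G) : Set G) :=
      hclosed.preimage QuotientGroup.continuous_mk
    rw [map_le_iff_le_comap]
    exact powSubgroup_le hpre fun x hx => ⟨⟨x, hx⟩, rfl⟩

theorem IsProPGroup.le_ker_powHom {p : ℕ} (hp : p.Prime) (hp2 : p ≠ 2)
    (hG : IsProPGroup p G) {N : Subgroup G} [N.Normal]
    (h : ⁅N, (⊤ : Subgroup G)⁆ ≤ powSubgroup p N) (i : ℕ) :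
    (powSeries p N (i + 1)).subgroupOf (powSeries p N i) ≤ (hG.powHom hp hp2 h i).ker :=
  fun _ hx => (QuotientGroup.eq_one_iff _).2 (pow_mem_powSeries (mem_subgroupOf.1 hx))

theorem IsProPGroup.relIndex_powSeries_succ {p : ℕ} (hp : p.Prime) (hp2 : p ≠ 2)
    (hG : IsProPGroup p G) {N : Subgroup G} [N.Normal] (hN : IsClosed (N : Set G))
    (h : ⁅N, (⊤ : Subgroup G)⁆ ≤ powSubgroup p N) (i : ℕ) :
    (powSeries p N (i + 2)).relIndex (powSeries p N (i + 1)) =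
      (hG.powHom hp hp2 h i).ker.index := by
  rw [index_ker, hG.range_powHom hp hp2 hN, ← relIndex_ker, QuotientGroup.ker_mk']

theorem IsProPGroup.relIndex_powSeries_ne_zero {p : ℕ} (hp : p.Prime) (hp2 : p ≠ 2)
    (hG : IsProPGroup p G) {N : Subgroup G} [N.Normal] (hN : IsClosed (N : Set G))
    (h : ⁅N, (⊤ : Subgroup G)⁆ ≤ powSubgroup p N) (hfin : (powSubgroup p N).relIndex N ≠ 0)
    (i : ℕ) : (powSeries p N (i + 1)).relIndex (powSeries p N i) ≠ 0 := by
  induction i with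
  | zero => exact hfin
  | succ i ih =>
    rw [hG.relIndex_powSeries_succ hp hp2 hN h]
    exact fun h0 => ih (Nat.eq_zero_of_zero_dvd
      (h0 ▸ index_dvd_of_le (hG.le_ker_powHom hp hp2 h i)))

theorem IsProPGroup.relIndex_powSeries_zero_ne_zero {p : ℕ} (hp : p.Prime) (hp2 : p ≠ 2)
    (hG : IsProPGroup p G) {N : Subgroup G} [N.Normal] (hN : IsClosed (N : Set G))
    (h : ⁅N, (⊤ : Subgroup G)⁆ ≤ powSubgroup p N) (hfin : (powSubgroup p N).relIndex N ≠ 0)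
    (i : ℕ) : (powSeries p N i).relIndex N ≠ 0 := by
  induction i with
  | zero => rw [powSeries, relIndex_self]; exact one_ne_zero
  | succ i ih =>
    exact relIndex_ne_zero_trans (hG.relIndex_powSeries_ne_zero hp hp2 hN h hfin i) ih

/-- From some term on, the power series of a powerfully embedded subgroup is uniform. -/
theorem IsProPGroup.exists_mem_powSeries_of_pow_mem {p : ℕ} (hp : p.Prime) (hp2 : p ≠ 2)
    (hG : IsProPGroup p G) {N : Subgroup G} [N.Normal] (hN : IsClosed (N : Set G))
    (h : ⁅N, (⊤ : Subgroup G)⁆ ≤ powSubgroup p N) (hfin : (powSubgroup p N).relIndex N ≠ 0) :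
    ∃ n, ∀ i, n ≤ i → ∀ x ∈ powSeries p N i, x ^ p ∈ powSeries p N (i + 2) →
      x ∈ powSeries p N (i + 1) := by
  have hne := hG.relIndex_powSeries_ne_zero hp hp2 hN h hfin
  -- The power maps make the successive indices non-increasing. Once they are constant, the kernel
  -- of `powHom` is exactly the next term.
  obtain ⟨n, hn⟩ := exists_eq_of_antitone
    (a := fun i => (powSeries p N (i + 1)).relIndex (powSeries p N i)) fun i => by
      refine Nat.le_of_dvd (Nat.pos_of_ne_zero (hne i)) ?_
      rw [hG.relIndex_powSeries_succ hp hp2 hN h]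
      exact index_dvd_of_le (hG.le_ker_powHom hp hp2 h i)
  refine ⟨n, fun i hi x hx hxp => ?_⟩
  have heq : (hG.powHom hp hp2 h i).ker.index =
      ((powSeries p N (i + 1)).subgroupOf (powSeries p N i)).index := by
    rw [← hG.relIndex_powSeries_succ hp hp2 hN h]
    exact (hn (i + 1) (by omega)).trans (hn i hi).symm
  have h1 := relIndex_mul_index (hG.le_ker_powHom hp hp2 h i)
  rw [heq] at h1
  have h2 := relIndex_eq_one.1 (Nat.eq_of_mul_eq_mul_right (Nat.pos_of_ne_zero (hne i))
    (h1.trans (one_mul _).symm))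
  have h3 : (⟨x, hx⟩ : powSeries p N i) ∈ (hG.powHom hp hp2 h i).ker :=
    (QuotientGroup.eq_one_iff _).2 hxp
  exact mem_subgroupOf.1 (h2 h3)

/-- Let `c i` be the index of `(A ∩ M_i) M_{i+1}` in `M_i`. The `p`-th powers of `A ∩ M_i` form a
subgroup `F` of the image of `A ∩ M_{i+1}`, whose index there times `c (i + 1)` divides `c i`. When
`c` stabilizes, `F` is the whole image. -/
theorem IsProPGroup.exists_inf_powSeries_eq_pow {p : ℕ} (hp : p.Prime) (hp2 : p ≠ 2)
    (hG : IsProPGroup p G) {N : Subgroup G} [N.Normal] (hN : IsClosed (N : Set G))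
    (h : ⁅N, (⊤ : Subgroup G)⁆ ≤ powSubgroup p N) (hfin : (powSubgroup p N).relIndex N ≠ 0)
    (A : Subgroup G) :
    ∃ n, ∀ i, n ≤ i → ∀ b ∈ A ⊓ powSeries p N (i + 1), ∃ a ∈ A ⊓ powSeries p N i,
      (b : G ⧸ powSeries p N (i + 2)) = (a ^ p : G) := by
  have hanti := powSeries_antitone (p := p) hN
  have hne := hG.relIndex_powSeries_ne_zero hp hp2 hN h hfin
  set P := powSeries p N
  set c : ℕ → ℕ := fun i => ((A ⊓ P i) ⊔ P (i + 1)).relIndex (P i)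
  have hc0 : ∀ i, c i ≠ 0 := fun i h0 => hne i
    (Nat.eq_zero_of_zero_dvd (h0 ▸ relIndex_dvd_of_le_left (P i) le_sup_right))
  have key : ∀ i, ∃ F : Subgroup (G ⧸ P (i + 2)),
      (∀ y ∈ F, ∃ a ∈ A ⊓ P i, y = (a ^ p : G)) ∧
      F.relIndex ((A ⊓ P (i + 1)).map (QuotientGroup.mk' (P (i + 2)))) * c (i + 1) ∣ c i := by
    intro i
    have hF : ∀ y ∈ ((A ⊓ P i).subgroupOf (P i)).map (hG.powHom hp hp2 h i),
        ∃ a ∈ A ⊓ P i, y = (a ^ p : G) := by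
      rintro _ ⟨x, hx, rfl⟩
      exact ⟨x, mem_subgroupOf.1 hx, rfl⟩
    refine ⟨((A ⊓ P i).subgroupOf (P i)).map (hG.powHom hp hp2 h i), hF, ?_⟩
    have hle : ((A ⊓ P i).subgroupOf (P i)).map (hG.powHom hp hp2 h i) ≤
        (A ⊓ P (i + 1)).map (QuotientGroup.mk' (P (i + 2))) := by
      intro y hy
      obtain ⟨a, ha, rfl⟩ := hF y hy
      exact ⟨a ^ p, ⟨A.pow_mem ha.1 p, pow_mem_powSeries ha.2⟩, rfl⟩
    have hc : c (i + 1) = ((A ⊓ P (i + 1)).map (QuotientGroup.mk' (P (i + 2)))).relIndex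
        ((P (i + 1)).map (QuotientGroup.mk' (P (i + 2)))) := by
      rw [relIndex_map_map, QuotientGroup.ker_mk', sup_of_le_left (hanti (Nat.le_succ (i + 1)))]
    rw [hc, relIndex_mul_relIndex _ _ _ hle (map_mono inf_le_right),
      ← hG.range_powHom hp hp2 hN h, MonoidHom.range_eq_map, relIndex_map_map, top_sup_eq,
      relIndex_top_right]
    refine index_dvd_of_le (H := (A ⊓ P i ⊔ P (i + 1)).subgroupOf (P i)) ?_
    rw [subgroupOf_sup inf_le_right (hanti (Nat.le_succ i))]
    exact sup_le_sup_left (hG.le_ker_powHom hp hp2 h i) _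
  obtain ⟨n, hn⟩ := exists_eq_of_antitone (a := c) fun i => by
    obtain ⟨F, _, hF⟩ := key i
    exact Nat.le_of_dvd (Nat.pos_of_ne_zero (hc0 i)) ((dvd_mul_left _ _).trans hF)
  refine ⟨n, fun i hi b hb => ?_⟩
  obtain ⟨F, hF1, hF⟩ := key i
  rw [hn (i + 1) (by omega), hn i hi] at hF
  have h1 := relIndex_eq_one.1 (Nat.dvd_one.1
    (Nat.dvd_of_mul_dvd_mul_right (Nat.pos_of_ne_zero (hc0 n)) (by rwa [one_mul])))
  exact hF1 _ (h1 (mem_map_of_mem _ hb))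

/-- Finitely many elements represent `A ∩ M_m` modulo `M_{m+1}`. For `m` large their iterated `p`-th
powers represent all deeper layers of `A`, so they topologically generate `A ∩ M_m`, which has
finite index in `A`. -/
theorem IsProPGroup.closedNoetherian {p : ℕ} (hp : p.Prime) (hp2 : p ≠ 2)
    (hG : IsProPGroup p G) {N : Subgroup G} [N.Normal] (hN : IsClosed (N : Set G))
    (h : ⁅N, (⊤ : Subgroup G)⁆ ≤ powSubgroup p N) (hfin : (powSubgroup p N).relIndex N ≠ 0) :
    ClosedNoetherian N := by
  have := hG.compactSpace
  have := hG.t2Space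
  have := hG.totallyDisconnectedSpace
  intro A hAN hA
  have hanti := powSeries_antitone (p := p) hN
  have hne := hG.relIndex_powSeries_ne_zero hp hp2 hN h hfin
  obtain ⟨m, hm⟩ := hG.exists_inf_powSeries_eq_pow hp hp2 hN h hfin A
  set P := powSeries p N
  have hfinm : Finite ((A ⊓ P m).map (QuotientGroup.mk' (P (m + 1)))) := by
    have : Finite ((P m).map (QuotientGroup.mk' (P (m + 1)))) := by
      apply Nat.finite_of_card_ne_zero
      rw [← relIndex_ker, QuotientGroup.ker_mk']
      exact hne m
    exact Finite.of_injective _ (inclusion_injective (map_mono inf_le_right))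
  obtain ⟨F, hFA, hF, hFm⟩ := (Set.exists_subset_image_finite_and
    (f := QuotientGroup.mk' (P (m + 1))) (s := (A ⊓ P m : Subgroup G)) (p := fun S =>
      S = (A ⊓ P m).map (QuotientGroup.mk' (P (m + 1))))).1
      ⟨((A ⊓ P m).map (QuotientGroup.mk' (P (m + 1))) : Subgroup _), subset_rfl,
        Set.toFinite _, rfl⟩
  set D := (Subgroup.closure F).topologicalClosure
  have hDA : D ≤ A ⊓ P m := topologicalClosure_minimal _ ((closure_le _).2 hFA)
    (hA.inter (isClosed_powSeries hN m))
  have step : ∀ j, ∀ b ∈ A ⊓ P (m + j), ∃ d ∈ D ⊓ P (m + j), d⁻¹ * b ∈ P (m + j + 1) := by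
    intro j
    induction j with
    | zero =>
      intro b hb
      have : (QuotientGroup.mk' (P (m + 1)) b) ∈ QuotientGroup.mk' (P (m + 1)) '' F := by
        rw [hFm]; exact mem_map_of_mem _ hb
      obtain ⟨d, hd, hdb⟩ := this
      have hdD : d ∈ D := le_topologicalClosure _ (subset_closure hd)
      exact ⟨d, ⟨hdD, (hDA hdD).2⟩, QuotientGroup.eq.1 hdb⟩
    | succ j ih =>
      intro b hb
      obtain ⟨a, ha, hab⟩ := hm (m + j) (by omega) b hb
      obtain ⟨d, hd, hda⟩ := ih a ha
      refine ⟨d ^ p, ⟨D.pow_mem hd.1 p, pow_mem_powSeries hd.2⟩, QuotientGroup.eq.1 ?_⟩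
      have hmul := hG.mk_mul_pow_powSeries hp hp2 h (g := d) (c := d⁻¹ * a)
        (hanti (Nat.le_succ _) hda)
      rw [(QuotientGroup.eq_one_iff ((d⁻¹ * a) ^ p)).2 (pow_mem_powSeries hda), mul_one,
        mul_inv_cancel_left] at hmul
      exact hmul.symm.trans hab.symm
  have step' : ∀ j, A ⊓ P m ≤ D ⊔ P (m + j) := by
    intro j
    induction j with
    | zero => exact inf_le_right.trans le_sup_right
    | succ j ih =>
      intro b hb
      obtain ⟨d, hd, r, hr, rfl⟩ := mem_sup_of_normal_right.1 (ih hb)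
      have hrA : r ∈ A := by
        have := A.mul_mem (A.inv_mem (hDA hd).1) hb.1
        simpa using this
      obtain ⟨e, he, her⟩ := step j r ⟨hrA, hr⟩
      have : d * r = (d * e) * (e⁻¹ * r) := by group
      rw [this]
      exact mul_mem_sup (D.mul_mem hd he.1) her
  have hADm : A ⊓ P m ≤ D := by
    intro x hx
    refine mem_of_forall_mem_sup_openNormalSubgroup (isClosed_topologicalClosure _) fun V => ?_
    obtain ⟨i, hi⟩ := hG.exists_powSeries_le hp hN V
    exact (step' i).trans (sup_le_sup_left ((hanti (Nat.le_add_left i m)).trans hi) _) hx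
  refine ClosedFG.of_relIndex_ne_zero hA inf_le_left ⟨F, hF, le_antisymm hDA hADm⟩ ?_
  rw [inf_relIndex_left]
  exact fun h0 => hG.relIndex_powSeries_zero_ne_zero hp hp2 hN h hfin m
    (relIndex_eq_zero_of_le_right hAN h0)

end

-- Series of finite length and the Noetherian property

universe u

section

variable {G : Type*} [Group G] [TopologicalSpace G] [IsTopologicalGroup G]

/-- The conditions of an `η`-series, with powerful embedding in quotients expressed in `G`. -/
structure IsRelativeEtaSeries (p : ℕ) (N : ℕ → Subgroup G) : Prop where
  zero : N 0 = ⊥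
  mono : Monotone N
  isClosed : ∀ i, IsClosed (N i : Set G)
  normal : ∀ i, (N i).Normal
  commutator_le : ∀ i, ⁅N (i + 1), (⊤ : Subgroup G)⁆ ≤ powSubgroup p (N (i + 1)) ⊔ N i

theorem IsEtaSeries.isRelativeEtaSeries [CompactSpace G] {p : ℕ} {N : ℕ → Subgroup G}
    (hN : IsEtaSeries p N) : IsRelativeEtaSeries p N where
  zero := hN.zero
  mono := hN.mono
  isClosed := hN.isClosed
  normal := hN.normal
  commutator_le i := by
    have := hN.normal i
    have : IsClosed (N i : Set G) := hN.isClosed i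
    have h := (le_topologicalClosure _).trans (hN.powerfullyEmbedded i).commutator_le
    rw [← map_powSubgroup QuotientGroup.continuous_mk, ← map_top_of_surjective _
      (QuotientGroup.mk'_surjective (N i)), ← map_commutator, map_le_iff_le_comap, comap_map_eq,
      QuotientGroup.ker_mk'] at h
    exact h

theorem IsRelativeEtaSeries.map {H : Type*} [Group H] [TopologicalSpace H] [IsTopologicalGroup H]
    [CompactSpace G] [T2Space H] {p : ℕ} {N : ℕ → Subgroup G} (hN : IsRelativeEtaSeries p N)
    {f : G →* H} (hf : Continuous f) (hs : Function.Surjective f) :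
    IsRelativeEtaSeries p fun i => (N i).map f where
  zero := by rw [hN.zero, Subgroup.map_bot]
  mono i j hij := map_mono (hN.mono hij)
  isClosed i := isClosed_map hf (hN.isClosed i)
  normal i := (hN.normal i).map f hs
  commutator_le i := by
    rw [← map_powSubgroup hf, ← map_top_of_surjective f hs, ← map_commutator, ← Subgroup.map_sup]
    exact map_mono (hN.commutator_le i)

theorem IsRelativeEtaSeries.shift {p : ℕ} {N : ℕ → Subgroup G} (hN : IsRelativeEtaSeries p N)
    (h : N 1 = ⊥) : IsRelativeEtaSeries p fun i => N (i + 1) where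
  zero := h
  mono _ _ hij := hN.mono (Nat.succ_le_succ hij)
  isClosed _ := hN.isClosed _
  normal _ := hN.normal _
  commutator_le _ := hN.commutator_le _

theorem IsRelativeEtaSeries.map_quotient {p : ℕ} {N : ℕ → Subgroup G}
    [CompactSpace G] (hN : IsRelativeEtaSeries p N) [(N 1).Normal] :
    IsRelativeEtaSeries p fun i => (N (i + 1)).map (QuotientGroup.mk' (N 1)) := by
  have : IsClosed (N 1 : Set G) := hN.isClosed 1
  refine (hN.map (f := QuotientGroup.mk' (N 1)) QuotientGroup.continuous_mk
    (QuotientGroup.mk'_surjective _)).shift ?_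
  rw [Subgroup.map_eq_bot_iff, QuotientGroup.ker_mk']

theorem IsRelativeEtaSeries.commutator_one_le {p : ℕ} {N : ℕ → Subgroup G}
    (hN : IsRelativeEtaSeries p N) : ⁅N 1, (⊤ : Subgroup G)⁆ ≤ powSubgroup p (N 1) := by
  simpa [hN.zero] using hN.commutator_le 0

/-- The shift of index shortens the series by one step, which drives the induction for the
Noetherian property. -/
theorem IsRelativeEtaSeries.commutator {p : ℕ} (hp : p.Prime) (hp2 : p ≠ 2)
    (hG : IsProPGroup p G) {N : ℕ → Subgroup G} (hN : IsRelativeEtaSeries p N)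
    (h : ⁅N 1, (⊤ : Subgroup G)⁆ = ⊥) :
    IsRelativeEtaSeries p fun i => ⁅N (i + 1), (⊤ : Subgroup G)⁆.topologicalClosure where
  zero := by
    have := hG.t2Space
    rw [h]
    exact le_bot_iff.1 (topologicalClosure_minimal _ le_rfl (by simp))
  mono i j hij := topologicalClosure_mono (commutator_mono (hN.mono (Nat.succ_le_succ hij)) le_rfl)
  isClosed i := isClosed_topologicalClosure _
  normal i := by
    have := hN.normal (i + 1)
    infer_instance
  commutator_le i := by
    have := hN.normal (i + 1)
    have := hN.normal (i + 1 + 1)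
    exact hG.commutator_commutator_le hp hp2 (hN.isClosed (i + 1)) (hN.commutator_le (i + 1))

/-- The commutators of the two generating sets suffice: modulo a closed normal `L` containing them,
each `s` commutes with topological generators of `G`, and `centralMod L` is closed and normal. -/
theorem ClosedNormallyFG.commutator [CompactSpace G] {R : Subgroup G} (hR : ClosedNormallyFG R)
    (hG : ClosedFG (⊤ : Subgroup G)) :
    ClosedNormallyFG ⁅R, (⊤ : Subgroup G)⁆.topologicalClosure := by
  obtain ⟨S, hS, hSR, hSL⟩ := hR
  obtain ⟨T, hT, hTG⟩ := hG
  refine ⟨Set.image2 (fun s t => ⁅s, t⁆) S T, hS.image2 _ hT, ?_, fun L hL hLc hSTL => ?_⟩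
  · rintro _ ⟨s, hs, t, _, rfl⟩
    exact le_topologicalClosure _ (commutator_mem_commutator (hSR hs) (mem_top t))
  · refine topologicalClosure_minimal _ ?_ hLc
    rw [commutator_top_le_iff]
    refine hSL _ inferInstance (isClosed_centralMod hLc) fun s hs => ?_
    rw [SetLike.mem_coe, mem_centralMod]
    set C : Subgroup G := (centralizer {(s : G ⧸ L)}).comap (QuotientGroup.mk' L)
    have hmem : ∀ g, g ∈ C ↔ ⁅s, g⁆ ∈ L := by
      intro g
      rw [mem_comap, mem_centralizer_singleton_iff, ← QuotientGroup.eq_one_iff,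
        commutatorElement_def, QuotientGroup.mk_mul, QuotientGroup.mk_mul, QuotientGroup.mk_mul,
        QuotientGroup.mk_inv, QuotientGroup.mk_inv, mul_inv_eq_one, mul_inv_eq_iff_eq_mul]
      exact eq_comm
    have hC : IsClosed (C : Set G) := by
      have : (C : Set G) = (fun g => ⁅s, g⁆) ⁻¹' (L : Set G) := Set.ext hmem
      rw [this]
      refine hLc.preimage ?_
      simp only [commutatorElement_def]
      fun_prop
    have hle : (⊤ : Subgroup G) ≤ C := by
      rw [← hTG]
      exact topologicalClosure_minimal _
        ((closure_le _).2 fun t ht => (hmem t).2 (hSTL ⟨s, hs, t, ht, rfl⟩)) hC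
    exact fun g => (hmem g).1 (hle (mem_top g))

theorem ClosedNormallyFG.closedFG_of_central {R : Subgroup G} (hR : ClosedNormallyFG R)
    (hRc : IsClosed (R : Set G)) (h : ⁅R, (⊤ : Subgroup G)⁆ = ⊥) : ClosedFG R := by
  obtain ⟨S, hS, hSR, hSL⟩ := hR
  have hle : (Subgroup.closure S).topologicalClosure ≤ R :=
    topologicalClosure_minimal _ ((closure_le _).2 hSR) hRc
  refine ⟨S, hS, le_antisymm hle (hSL _ ?_ (isClosed_topologicalClosure _)
    (subset_closure.trans (le_topologicalClosure _)))⟩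
  refine ⟨fun x hx g => ?_⟩
  have : ⁅g, x⁆ = 1 := by
    rw [← mem_bot, ← h, commutator_comm]
    exact commutator_mem_commutator (mem_top g) (hle hx)
  rw [commutatorElement_def, mul_inv_eq_one] at this
  rwa [this]

end

/-- Generation as a closed normal subgroup is the hypothesis that passes both to quotients and to
`[R, G]`, as the induction requires. -/
theorem IsProPGroup.closedNoetherian_of_isRelativeEtaSeries {p : ℕ} (hp : p.Prime) (hp2 : p ≠ 2)
    (k : ℕ) : ∀ {G : Type u} [Group G] [TopologicalSpace G] [IsTopologicalGroup G],
      IsProPGroup p G → ClosedFG (⊤ : Subgroup G) → ∀ N : ℕ → Subgroup G,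
      IsRelativeEtaSeries p N → ClosedNormallyFG (N k) → ClosedNoetherian (N k) := by
  induction k with
  | zero =>
    intro G _ _ _ hG _ N hN _ A hA _
    have := hG.t2Space
    rw [hN.zero, le_bot_iff] at hA
    refine ⟨∅, Set.finite_empty, ?_⟩
    rw [Subgroup.closure_empty, hA]
    exact le_bot_iff.1 (topologicalClosure_minimal _ le_rfl (by simp))
  | succ k ih =>
    intro G _ _ _ hG hfg N hN hR
    have := hG.compactSpace
    have := hG.t2Space
    have := hN.normal 1
    have hM := hN.isClosed 1
    have : IsClosed (N 1 : Set G) := hM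
    have hquot : ClosedNoetherian ((N (k + 1)).map (QuotientGroup.mk' (N 1))) := by
      refine ih (hG.quotient hM) ?_ _ hN.map_quotient
        (hR.map (f := QuotientGroup.mk' (N 1)) QuotientGroup.continuous_mk)
      rw [← map_top_of_surjective _ (QuotientGroup.mk'_surjective (N 1))]
      exact hfg.map QuotientGroup.continuous_mk
    refine ClosedNoetherian.of_quotient hM (hG.closedNoetherian hp hp2 hM hN.commutator_one_le ?_)
      hquot
    have hPc : IsClosed (powSubgroup p (N 1) : Set G) := isClosed_powSubgroup p (N 1)
    set f := QuotientGroup.mk' (powSubgroup p (N 1))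
    have hf : Continuous f := QuotientGroup.continuous_mk
    have hfs : Function.Surjective f := QuotientGroup.mk'_surjective _
    have hG' := hG.quotient hPc
    have hN' := hN.map hf hfs
    have hfg' : ClosedFG (⊤ : Subgroup (G ⧸ powSubgroup p (N 1))) := by
      rw [← map_top_of_surjective f hfs]
      exact hfg.map hf
    have hR' : ClosedNormallyFG ((N (k + 1)).map f) := hR.map hf
    have hcomm : ⁅(N 1).map f, (⊤ : Subgroup (G ⧸ powSubgroup p (N 1)))⁆ = ⊥ := by
      rw [← map_top_of_surjective f hfs, ← map_commutator, Subgroup.map_eq_bot_iff,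
        QuotientGroup.ker_mk']
      exact hN.commutator_one_le
    -- Modulo `N 1 ^ p` the closure of `[R, G]` is Noetherian by induction. The quotient of `R` by
    -- it is central and finitely generated, so `R` is Noetherian and the image of `N 1` is finite.
    have hK := ih hG' hfg' _ (hN'.commutator hp hp2 hG' hcomm) (hR'.commutator hfg')
    set R := (N (k + 1)).map f
    have hRn : R.Normal := hN'.normal (k + 1)
    set K := ⁅R, (⊤ : Subgroup (G ⧸ powSubgroup p (N 1)))⁆.topologicalClosure
    have hKc : IsClosed (K : Set (G ⧸ powSubgroup p (N 1))) := isClosed_topologicalClosure _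
    have hRnoeth : ClosedNoetherian R := by
      refine ClosedNoetherian.of_quotient hKc hK ?_
      have hg : Continuous (QuotientGroup.mk' K) := QuotientGroup.continuous_mk
      have hgs := QuotientGroup.mk'_surjective K
      have hRn' : (R.map (QuotientGroup.mk' K)).Normal := hRn.map _ hgs
      have hRc := isClosed_map hg (hN'.isClosed (k + 1))
      have hcomm' : ⁅R.map (QuotientGroup.mk' K),
          (⊤ : Subgroup ((G ⧸ powSubgroup p (N 1)) ⧸ K))⁆ = ⊥ := by
        rw [← map_top_of_surjective _ hgs, ← map_commutator, Subgroup.map_eq_bot_iff,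
          QuotientGroup.ker_mk']
        exact le_topologicalClosure _
      have hle := hcomm'.trans_le (bot_le (a := powSubgroup p (R.map (QuotientGroup.mk' K))))
      exact (hG'.quotient hKc).closedNoetherian hp hp2 hRc hle (relIndex_powSubgroup_ne_zero hp hle
        ((hR'.map hg).closedFG_of_central hRc hcomm'))
    have hM' := hRnoeth ((N 1).map f) (map_mono (hN.mono (Nat.le_add_left 1 k)))
      (isClosed_map hf hM)
    have hMn := hN'.normal 1
    have hidx := relIndex_powSubgroup_ne_zero hp (hcomm.trans_le bot_le) hM'
    rwa [← map_powSubgroup hf, (Subgroup.map_eq_bot_iff _).2 (QuotientGroup.ker_mk' _).ge,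
      relIndex_bot_left, ← relIndex_ker, QuotientGroup.ker_mk'] at hidx

/-! ### Elements of finite order -/

section

variable {G : Type*} [Group G] [TopologicalSpace G] [IsTopologicalGroup G]

/-- The part of the order prime to `p` dies in every finite `p`-quotient. -/
theorem IsProPGroup.exists_pow_prime_pow_eq_one {p : ℕ} (hp : p.Prime) (hG : IsProPGroup p G)
    {g : G} (hg : IsOfFinOrder g) : ∃ m, g ^ p ^ m = 1 := by
  have := hG.compactSpace
  have := hG.t2Space
  have := hG.totallyDisconnectedSpace
  obtain ⟨m, s, hs, hms⟩ := Nat.exists_eq_pow_mul_and_not_dvd hg.orderOf_pos.ne' p hp.ne_one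
  refine ⟨m, ?_⟩
  rw [← mem_bot]
  refine mem_of_forall_mem_sup_openNormalSubgroup (by simp) fun V => ?_
  rw [bot_sup_eq]
  obtain ⟨_, hpg⟩ := hG.isPGroup_quotient V
  obtain ⟨n, hn⟩ := hpg ((g ^ p ^ m : G) : G ⧸ (V : Subgroup G))
  have hs1 : ((g ^ p ^ m : G) : G ⧸ (V : Subgroup G)) ^ s = 1 := by
    rw [← QuotientGroup.mk_pow, ← pow_mul, ← hms, pow_orderOf_eq_one, QuotientGroup.mk_one]
  rw [← QuotientGroup.eq_one_iff, ← orderOf_eq_one_iff]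
  exact Nat.eq_one_of_dvd_coprimes (((hp.coprime_iff_not_dvd).2 hs).pow_left n)
    (orderOf_dvd_of_pow_eq_one hn) (orderOf_dvd_of_pow_eq_one hs1)

section Uniform

variable {p : ℕ} {N : Subgroup G} {n : ℕ}

theorem IsProPGroup.eq_one_of_isOfFinOrder (hp : p.Prime)
    (hG : IsProPGroup p G) (hN : IsClosed (N : Set G))
    (hn : ∀ i, n ≤ i → ∀ x ∈ powSeries p N i, x ^ p ∈ powSeries p N (i + 2) →
      x ∈ powSeries p N (i + 1)) {x : G} (hx : x ∈ powSeries p N n) (hxo : IsOfFinOrder x) :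
    x = 1 := by
  have key : ∀ y ∈ powSeries p N n, y ^ p = 1 → y = 1 := by
    intro y hy hyp
    have hmem : ∀ j, y ∈ powSeries p N (n + j) := by
      intro j
      induction j with
      | zero => exact hy
      | succ j ih => exact hn (n + j) (by omega) y ih (hyp ▸ one_mem _)
    exact hG.eq_one_of_mem_powSeries hp hN fun i =>
      powSeries_antitone hN (Nat.le_add_left i n) (hmem i)
  obtain ⟨m, hm⟩ := hG.exists_pow_prime_pow_eq_one hp hxo
  induction m with
  | zero => simpa using hm
  | succ m ih =>
    rw [pow_succ, pow_mul] at hm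
    exact ih (key _ (pow_mem hx _) hm)

/-- Elements of finite order centralize a uniform term of the power series. -/
theorem IsProPGroup.commute_of_isOfFinOrder (hp : p.Prime) (hp2 : p ≠ 2)
    (hG : IsProPGroup p G) [N.Normal] (hN : IsClosed (N : Set G))
    (h : ⁅N, (⊤ : Subgroup G)⁆ ≤ powSubgroup p N)
    (hn : ∀ i, n ≤ i → ∀ x ∈ powSeries p N i, x ^ p ∈ powSeries p N (i + 2) →
      x ∈ powSeries p N (i + 1)) {g : G} (hg : IsOfFinOrder g) {u : G}
    (hu : u ∈ powSeries p N n) : Commute u g := by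
  obtain ⟨m, hm⟩ := hG.exists_pow_prime_pow_eq_one hp hg
  clear hg
  induction m generalizing g with
  | zero =>
    rw [pow_zero, pow_one] at hm
    rw [hm]
    exact Commute.one_right u
  | succ m ih =>
    have hgp : Commute u (g ^ p) := ih (by rwa [← pow_mul, ← pow_succ'])
    -- As `u` commutes with `g ^ p`, `(g c) ^ p = g ^ p`, so `c ^ p` is trivial modulo `M_{i+2}`
    -- whenever `c ∈ M_i`. Uniformity pushes `c` down the whole series, whose intersection is
    -- trivial.
    set c := g⁻¹ * (u * g * u⁻¹)
    have hgc : g * c = u * g * u⁻¹ := mul_inv_cancel_left _ _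
    have hmem : ∀ j, c ∈ powSeries p N (n + j) := by
      intro j
      induction j with
      | zero =>
        have h1 := (powSeries_normal p N n).conj_mem u hu g⁻¹
        rw [inv_inv] at h1
        have h2 := mul_mem h1 (inv_mem hu)
        rw [Nat.add_zero]
        simpa only [c, mul_assoc] using h2
      | succ j ihj =>
        refine hn (n + j) (by omega) c ihj ?_
        have h1 := hG.mk_mul_pow_powSeries hp hp2 h (g := g) ihj
        rw [hgc, conj_pow, hgp.eq, mul_inv_cancel_right] at h1
        exact (QuotientGroup.eq_one_iff _).1 (mul_eq_left.1 h1.symm)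
    have hc : c = 1 := hG.eq_one_of_mem_powSeries hp hN fun i =>
      powSeries_antitone hN (Nat.le_add_left i n) (hmem i)
    rw [hc, mul_one] at hgc
    exact (mul_inv_eq_iff_eq_mul.1 hgc.symm)

end Uniform

end

open scoped IsMulCommutative in
-- `U ∩ T` is central of finite index in `T`, so transfer makes `t ↦ t ^ [T : Z(T)]` a homomorphism
-- to an abelian group. It sends the torsion generators, hence all of `T`, to torsion elements.
theorem isOfFinOrder_of_mem_closure {G : Type*} [Group G] {U : Subgroup G}
    (hU : ∀ g : G, IsOfFinOrder g → ∀ u ∈ U, Commute u g)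
    (hidx : U.relIndex (Subgroup.closure {g : G | IsOfFinOrder g}) ≠ 0) {x : G}
    (hx : x ∈ Subgroup.closure {g : G | IsOfFinOrder g}) : IsOfFinOrder x := by
  set T := Subgroup.closure {g : G | IsOfFinOrder g}
  have hTU : T ≤ centralizer (U : Set G) :=
    (closure_le _).2 fun g hg => mem_centralizer_iff.2 fun u hu => hU g hg u hu
  have hle : U.subgroupOf T ≤ center T := fun y hy =>
    mem_center_iff.2 fun t => Subtype.ext
      (mem_centralizer_iff.1 (hTU t.2) y (mem_subgroupOf.1 hy)).symm
  have hfin : (U.subgroupOf T).FiniteIndex := ⟨hidx⟩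
  have : (center T).FiniteIndex := finiteIndex_of_le hle
  obtain ⟨f, hf⟩ : ∃ f : T →* center T, ∀ t, ((f t : T) : G) = (t : G) ^ (center T).index :=
    ⟨MonoidHom.transferCenterPow T, fun _ => rfl⟩
  have key : T ≤ ((CommGroup.torsion (center T)).comap f).map T.subtype :=
    (closure_le _).2 fun g hg => ⟨⟨g, subset_closure hg⟩,
      f.isOfFinOrder (Submonoid.isOfFinOrder_coe.1 hg), rfl⟩
  obtain ⟨y, hy, rfl⟩ := key hx
  have h1 : IsOfFinOrder (f y) := hy
  have h2 := T.subtype.isOfFinOrder ((center T).subtype.isOfFinOrder h1)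
  rw [subtype_apply, subtype_apply, hf] at h2
  exact h2.of_pow FiniteIndex.index_ne_zero

theorem IsProPGroup.exists_finite_subgroup_isOfFinOrder_mem {p : ℕ} (hp : p.Prime) (hp2 : p ≠ 2)
    (k : ℕ) : ∀ {G : Type u} [Group G] [TopologicalSpace G] [IsTopologicalGroup G],
      IsProPGroup p G → ClosedNoetherian (⊤ : Subgroup G) → ∀ N : ℕ → Subgroup G,
      IsRelativeEtaSeries p N → N k = ⊤ →
      ∃ T : Subgroup G, Finite T ∧ ∀ g : G, IsOfFinOrder g → g ∈ T := by
  induction k with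
  | zero =>
    intro G _ _ _ _ _ N hN hk
    refine ⟨⊥, inferInstance, fun g _ => ?_⟩
    rw [← hN.zero, hk]
    exact mem_top g
  | succ k ih =>
    intro G _ _ _ hG hnoeth N hN hk
    have := hG.compactSpace
    have := hG.t2Space
    have := hN.normal 1
    have hM := hN.isClosed 1
    have : IsClosed (N 1 : Set G) := hM
    have hs := QuotientGroup.mk'_surjective (N 1)
    obtain ⟨T', hT'fin, hT'⟩ := ih (hG.quotient hM) (by
        rw [← map_top_of_surjective _ hs]
        exact hnoeth.map QuotientGroup.continuous_mk (by simp)) _ hN.map_quotient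
      (by rw [hk, map_top_of_surjective _ hs])
    have hfin := relIndex_powSubgroup_ne_zero hp hN.commutator_one_le (hnoeth (N 1) le_top hM)
    obtain ⟨n, hn⟩ := hG.exists_mem_powSeries_of_pow_mem hp hp2 hM hN.commutator_one_le hfin
    set U := powSeries p (N 1) n
    set T := Subgroup.closure {g : G | IsOfFinOrder g}
    have hTT' : T.map (QuotientGroup.mk' (N 1)) ≤ T' := by
      rw [map_le_iff_le_comap]
      exact (closure_le _).2 fun g hg => hT' _ ((QuotientGroup.mk' (N 1)).isOfFinOrder hg)
    have hMT : (N 1).relIndex T ≠ 0 := by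
      have : Finite (T.map (QuotientGroup.mk' (N 1))) :=
        Finite.of_injective _ (inclusion_injective hTT')
      rw [← QuotientGroup.ker_mk' (N 1), relIndex_ker]
      exact Nat.card_pos.ne'
    have hUT : U.relIndex T ≠ 0 := relIndex_ne_zero_trans
      (hG.relIndex_powSeries_zero_ne_zero hp hp2 hM hN.commutator_one_le hfin n) hMT
    have htors : ∀ x ∈ T, IsOfFinOrder x := fun x hx => isOfFinOrder_of_mem_closure
      (fun g hg u hu => hG.commute_of_isOfFinOrder hp hp2 hM hN.commutator_one_le hn hg hu) hUT hx
    -- `T` is torsion and `U` torsion-free, so the finite index of `U ∩ T` in `T` is the order of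
    -- `T`.
    have hbot : U ⊓ T = ⊥ := le_bot_iff.1 fun x hx =>
      mem_bot.2 (hG.eq_one_of_isOfFinOrder hp hM hn hx.1 (htors x hx.2))
    rw [← inf_relIndex_right, hbot, relIndex_bot_left] at hUT
    exact ⟨T, Nat.finite_of_card_ne_zero hUT, fun g hg => subset_closure hg⟩

end PowerfulClass

theorem corollaryl {p : ℕ} (hp : p.Prime) (hp2 : p ≠ 2)
    {G : Type*} [Group G] [TopologicalSpace G] [IsTopologicalGroup G]
    (hG : PowerfulClass.IsProPGroup p G)
    (hfg : PowerfulClass.IsTopologicallyFG G)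
    (hpc : PowerfulClass.HasFinitePowerfulClass G p) :
    ∃ T : Subgroup G, (T : Set G) = {g : G | IsOfFinOrder g} ∧ (T : Set G).Finite := by
  have := hG.compactSpace
  obtain ⟨N, hN, k, hk⟩ := hpc
  have hN' := hN.isRelativeEtaSeries
  have hnormal : PowerfulClass.ClosedNormallyFG (N k) := by
    obtain ⟨S, hS, hST⟩ := hfg
    refine ⟨S, hS, by simp [hk], fun L _ hL hSL => ?_⟩
    rw [hk, ← hST]
    exact Subgroup.topologicalClosure_minimal _ ((Subgroup.closure_le _).2 hSL) hL
  have hnoeth := hG.closedNoetherian_of_isRelativeEtaSeries hp hp2 k hfg N hN' hnormal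
  rw [hk] at hnoeth
  obtain ⟨T, hT, hmem⟩ := hG.exists_finite_subgroup_isOfFinOrder_mem hp hp2 k hnoeth N hN' hk
  refine ⟨T, Set.ext fun g => ⟨fun hg => ?_, hmem g⟩, Set.toFinite _⟩
  exact Submonoid.isOfFinOrder_coe.2 (isOfFinOrder_of_finite (⟨g, hg⟩ : T))
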